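/- **Definitions.** Let $\mathcal C$ be a category. A *b-category structure* on $\mathcal C$ is a functor $\otimes:\mathcal C\times\mathcal C\to\mathcal C$ with isomorphisms $\beta_{X,Y,Z}:X\otimes(Y\otimes Z)\to Y\otimes(X\otimes Z)$, natural in $X,Y,Z$, such that for all $X,Y,Z,W$ $$\beta_{Y,Z,X\otimes W}\,(1_Y\otimes\beta_{X,Z,W})\,\beta_{X,Y,Z\otimes W}=(1_Z\otimes\beta_{X,Y,W})\,\beta_{X,Z,Y\otimes W}\,(1_X\otimes\beta_{Y,Z,W}).$$ It is *symmetric* if $\beta_{X,Y,Z}\,\beta_{Y,X,Z}=1$ for all $X,Y,Z$. A *unital* b-category structure has in addition an object $I$ and isomorphisms $\rho_X:X\otimes I\to X$, natural in $X$, such that, with $$c_{X,Y}=(1_Y\otimes\rho_X)\,\beta_{X,Y,I}\,(1_X\otimes\rho_Y^{-1}):X\otimes Y\to Y\otimes X,$$ one has, for all $X,Y,Z,W$ (writing $XY$ for $X\otimes Y$ and $1f$ for $1\otimes f$), $$(1_X c_{ZW,Y})\,\beta_{ZW,X,Y}\,c_{XY,ZW}=(1_X\beta_{Z,Y,W})\,(1_X1_Zc_{W,Y})\,\beta_{Z,X,WY}\,(1_Z\beta_{W,X,Y})\,(1_Zc_{XY,W})\,\beta_{XY,Z,W},$$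 $$\beta_{X,I,Y}\,(1_Xc_{Y,I})=c_{XY,I}\,\rho_{XY}^{-1}\,(1_X\rho_Y).$$ A *b-functor structure* on a functor $F:\mathcal C\to\mathcal D$ between b-categories is a natural collection of isomorphisms $F_{X,Y}:F(X\otimes Y)\to F(X)\otimes F(Y)$ with $$\beta_{F(X),F(Y),F(Z)}\,(1\otimes F_{Y,Z})\,F_{X,Y\otimes Z}=(1\otimes F_{X,Z})\,F_{Y,X\otimes Z}\,F(\beta_{X,Y,Z}).$$ For unital b-categories, a *unital b-functor structure* has in addition an isomorphism $\phi:F(I)\to I$ with $\rho_{F(X)}\,(1\otimes\phi)\,F_{X,I}=F(\rho_X)$ for all $X$. Associativity constraints of monoidal categories are written $\alpha_{X,Y,Z}:X\otimes(Y\otimes Z)\to(X\otimes Y)\otimes Z$, and monoidal functors are strong, with constraints $F(X\otimes Y)\to F(X)\otimes F(Y)$ and $F(I)\to I$. **Theorem 2.3.** (i) For every category $\mathcal C$ there is a bijection between the unital b-category structures on $\mathcal C$ and the braided monoidal structures on $\mathcal C$, which keeps $\otimes$, $I$ and $\rho$. It sends $(\otimes,\beta,I,\rho)$ to the braided monoidal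 structure with braiding $c$ as above, with $$\alpha_{X,Y,Z}=c_{Z,X\otimes Y}\,\beta_{Z,X,Y}^{-1}\,(1_X\otimes c_{Z,Y}^{-1})$$ and with $\lambda_X=\rho_X\,c_{I,X}$. Its inverse sends a braided monoidal structure $(\otimes,I,\alpha,\lambda,\rho,c)$ to the unital b-category structure with $$\beta_{X,Y,Z}=\alpha_{Y,X,Z}^{-1}\,(c_{X,Y}\otimes 1_Z)\,\alpha_{X,Y,Z}.$$ (ii) This bijection restricts to a bijection between the symmetric unital b-category structures and the symmetric monoidal structures on $\mathcal C$. (iii) Let $\mathcal C,\mathcal D$ be braided monoidal categories, regarded also as unital b-categories through (i) (by (i), every unital b-category arises so from exactly one braided monoidal structure), and let $F:\mathcal C\to\mathcal D$ be a functor. Then the unital b-functor structures on $F$ are in bijection with the braided monoidal functor structures on $F$; the bijection keeps the isomorphisms $F_{X,Y}:F(X\otimes Y)\to F(X)\otimes F(Y)$ and $\phi:F(I)\to I$. -/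

import Mathlib

open CategoryTheory

universe v₁ v₂ u₁ u₂

namespace BCat

/-- The tensor product `X ⊗ Y` of two objects, for a tensor product functor `T`. -/
abbrev ten {C : Type u₁} [Category.{v₁} C] (T : C × C ⥤ C) (X Y : C) : C := T.obj (X, Y)

/-- The tensor product `f ⊗ g` of two morphisms, for a tensor product functor `T`. -/
abbrev tenHom {C : Type u₁} [Category.{v₁} C] (T : C × C ⥤ C) {X X' Y Y' : C}
    (f : X ⟶ X') (g : Y ⟶ Y') : ten T X Y ⟶ ten T X' Y' :=
  T.map (Prod.mkHom f g)

/-- The isomorphism `1 ⊗ f : X ⊗ Y ≅ X ⊗ Y'` for an isomorphism `f : Y ≅ Y'`. -/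
@[simps]
def oneTen {C : Type u₁} [Category.{v₁} C] (T : C × C ⥤ C) (X : C) {Y Y' : C} (f : Y ≅ Y') :
    ten T X Y ≅ ten T X Y' where
  hom := tenHom T (𝟙 X) f.hom
  inv := tenHom T (𝟙 X) f.inv
  hom_inv_id := by
    rw [← T.map_comp]
    exact (congrArg T.map (by ext <;> simp)).trans (T.map_id _)
  inv_hom_id := by
    rw [← T.map_comp]
    exact (congrArg T.map (by ext <;> simp)).trans (T.map_id _)

/-! ### b-categories and unital b-categories -/

/-- The data of a b-category with underlying category `C`: a tensor product functor and a
collection of isomorphisms `β_{X,Y,Z} : X ⊗ (Y ⊗ Z) → Y ⊗ (X ⊗ Z)`. -/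
structure BData (C : Type u₁) [Category.{v₁} C] where
  tensor : C × C ⥤ C
  β : ∀ X Y Z : C, ten tensor X (ten tensor Y Z) ≅ ten tensor Y (ten tensor X Z)

/-- The axioms of a b-category: `β` is natural in its three arguments, and the b-axiom holds. -/
structure BData.IsBCategory {C : Type u₁} [Category.{v₁} C] (U : BData C) : Prop where
  β_natural : ∀ {X X' Y Y' Z Z' : C} (f : X ⟶ X') (g : Y ⟶ Y') (h : Z ⟶ Z'),
    tenHom U.tensor f (tenHom U.tensor g h) ≫ (U.β X' Y' Z').hom =
      (U.β X Y Z).hom ≫ tenHom U.tensor g (tenHom U.tensor f h)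
  b_axiom : ∀ X Y Z W : C,
    (U.β X Y (ten U.tensor Z W)).hom ≫ (oneTen U.tensor Y (U.β X Z W)).hom ≫
        (U.β Y Z (ten U.tensor X W)).hom =
      (oneTen U.tensor X (U.β Y Z W)).hom ≫ (U.β X Z (ten U.tensor Y W)).hom ≫
        (oneTen U.tensor Z (U.β X Y W)).hom

/-- A b-category is symmetric if `β_{X,Y,Z} β_{Y,X,Z} = 1` for all `X`, `Y`, `Z`. -/
def BData.IsSymmetric {C : Type u₁} [Category.{v₁} C] (U : BData C) : Prop :=
  ∀ X Y Z : C, (U.β Y X Z).hom ≫ (U.β X Y Z).hom = 𝟙 (ten U.tensor Y (ten U.tensor X Z))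

/-- The data of a unital b-category with underlying category `C`: the data of a b-category,
a unit object `I` and a collection of isomorphisms `ρ_X : X ⊗ I → X`. -/
structure UnitalBData (C : Type u₁) [Category.{v₁} C] extends BData C where
  unit : C
  ρ : ∀ X : C, ten tensor X unit ≅ X

/-- The isomorphism `c_{X,Y} : X ⊗ Y → X ⊗ (Y ⊗ I) → Y ⊗ (X ⊗ I) → Y ⊗ X`. -/
def UnitalBData.c {C : Type u₁} [Category.{v₁} C] (U : UnitalBData C) (X Y : C) :
    ten U.tensor X Y ≅ ten U.tensor Y X :=
  (oneTen U.tensor X (U.ρ Y)).symm ≪≫ U.β X Y U.unit ≪≫ oneTen U.tensor Y (U.ρ X)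

/-- The axioms for the unit of a unital b-category: `ρ` is natural, and the two coherence
diagrams relating `β`, `ρ` and `c` commute. -/
structure UnitalBData.IsUnital {C : Type u₁} [Category.{v₁} C] (U : UnitalBData C) : Prop where
  ρ_natural : ∀ {X X' : C} (f : X ⟶ X'),
    tenHom U.tensor f (𝟙 U.unit) ≫ (U.ρ X').hom = (U.ρ X).hom ≫ f
  /-- The two composites `(X ⊗ Y) ⊗ (Z ⊗ W) → X ⊗ (Y ⊗ (Z ⊗ W))` agree. -/
  unit_axiom₁ : ∀ X Y Z W : C,
    (U.c (ten U.tensor X Y) (ten U.tensor Z W)).hom ≫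
        (U.β (ten U.tensor Z W) X Y).hom ≫
        (oneTen U.tensor X (U.c (ten U.tensor Z W) Y)).hom =
      (U.β (ten U.tensor X Y) Z W).hom ≫
        (oneTen U.tensor Z (U.c (ten U.tensor X Y) W)).hom ≫
        (oneTen U.tensor Z (U.β W X Y)).hom ≫
        (U.β Z X (ten U.tensor W Y)).hom ≫
        (oneTen U.tensor X (oneTen U.tensor Z (U.c W Y))).hom ≫
        (oneTen U.tensor X (U.β Z Y W)).hom
  /-- The two composites `X ⊗ (Y ⊗ I) → I ⊗ (X ⊗ Y)` agree. -/
  unit_axiom₂ : ∀ X Y : C,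
    (oneTen U.tensor X (U.c Y U.unit)).hom ≫ (U.β X U.unit Y).hom =
      (oneTen U.tensor X (U.ρ Y)).hom ≫ (U.ρ (ten U.tensor X Y)).inv ≫
        (U.c (ten U.tensor X Y) U.unit).hom

/-- A structure of unital b-category on the category `C`. -/
structure UnitalBStructure (C : Type u₁) [Category.{v₁} C] extends UnitalBData C where
  isBCategory : toBData.IsBCategory
  isUnital : toUnitalBData.IsUnital

/-! ### b-functors and unital b-functors -/

/-- A structure of b-functor on the functor `F`: a natural collection of isomorphisms
`F_{X,Y} : F (X ⊗ Y) → F X ⊗ F Y` compatible with `β`. -/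
structure BFunctorStructure {C : Type u₁} [Category.{v₁} C] {D : Type u₂} [Category.{v₂} D]
    (U : BData C) (V : BData D) (F : C ⥤ D) where
  iso : ∀ X Y : C, F.obj (ten U.tensor X Y) ≅ ten V.tensor (F.obj X) (F.obj Y)
  iso_natural : ∀ {X X' Y Y' : C} (f : X ⟶ X') (g : Y ⟶ Y'),
    F.map (tenHom U.tensor f g) ≫ (iso X' Y').hom =
      (iso X Y).hom ≫ tenHom V.tensor (F.map f) (F.map g)
  iso_β : ∀ X Y Z : C,
    (iso X (ten U.tensor Y Z)).hom ≫ (oneTen V.tensor (F.obj X) (iso Y Z)).hom ≫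
        (V.β (F.obj X) (F.obj Y) (F.obj Z)).hom =
      F.map (U.β X Y Z).hom ≫ (iso Y (ten U.tensor X Z)).hom ≫
        (oneTen V.tensor (F.obj Y) (iso X Z)).hom

/-- A structure of unital b-functor on the functor `F`: a structure of b-functor and an
isomorphism `φ : F I → I` compatible with `ρ`. -/
structure UnitalBFunctorStructure {C : Type u₁} [Category.{v₁} C] {D : Type u₂} [Category.{v₂} D]
    (U : UnitalBData C) (V : UnitalBData D) (F : C ⥤ D) extends
    BFunctorStructure U.toBData V.toBData F where
  φ : F.obj U.unit ≅ V.unit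
  iso_ρ : ∀ X : C,
    (iso X U.unit).hom ≫ (oneTen V.tensor (F.obj X) φ).hom ≫ (V.ρ (F.obj X)).hom =
      F.map (U.ρ X).hom

/-! ### Braided and symmetric monoidal structures on a fixed category -/

/-- A structure of braided monoidal category on the category `C`. -/
structure BraidedMonoidalStructure (C : Type u₁) [Category.{v₁} C] where
  monoidal : MonoidalCategory C
  braided : BraidedCategory C

/-- A structure of symmetric monoidal category on the category `C`. -/
structure SymmetricMonoidalStructure (C : Type u₁) [Category.{v₁} C] where
  monoidal : MonoidalCategory C
  symmetric : SymmetricCategory C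

/-- The braided monoidal structure underlying a symmetric monoidal structure. -/
def SymmetricMonoidalStructure.toBraided {C : Type u₁} [Category.{v₁} C]
    (S : SymmetricMonoidalStructure C) : BraidedMonoidalStructure C where
  monoidal := S.monoidal
  braided := S.symmetric.toBraidedCategory

/-- The data (without axioms) of a braided monoidal category. -/
structure BraidedMonoidalData (C : Type u₁) [Category.{v₁} C] where
  monoidalStruct : MonoidalCategoryStruct C
  braiding : ∀ X Y : C,
    MonoidalCategoryStruct.tensorObj X Y ≅ MonoidalCategoryStruct.tensorObj Y X

/-- The data of a braided monoidal structure. -/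
def BraidedMonoidalStructure.toData {C : Type u₁} [Category.{v₁} C]
    (B : BraidedMonoidalStructure C) : BraidedMonoidalData C where
  monoidalStruct := B.monoidal.toMonoidalCategoryStruct
  braiding := B.braided.braiding

/-! ### Passing from one kind of data to the other -/

open MonoidalCategory in
/-- The unital b-data of a braided monoidal category, with the same tensor product, unit object
and `ρ`, and with `β_{X,Y,Z}` the composite
`X ⊗ (Y ⊗ Z) → (X ⊗ Y) ⊗ Z → (Y ⊗ X) ⊗ Z → Y ⊗ (X ⊗ Z)` of associativity constraints and
the braiding `c_{X,Y} ⊗ 1`. -/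
def unitalBDataOfBraided (C : Type u₁) [Category.{v₁} C] [MonoidalCategory C]
    [BraidedCategory C] : UnitalBData C where
  tensor := tensor C
  β X Y Z := (α_ X Y Z).symm ≪≫ whiskerRightIso (BraidedCategory.braiding X Y) Z ≪≫ α_ Y X Z
  unit := 𝟙_ C
  ρ X := ρ_ X

/-- The unital b-data of a braided monoidal structure. -/
def BraidedMonoidalStructure.toUnitalBData {C : Type u₁} [Category.{v₁} C]
    (B : BraidedMonoidalStructure C) : UnitalBData C :=
  @unitalBDataOfBraided C _ B.monoidal B.braided

/-- The composite `X ⊗ (Y ⊗ Z) → X ⊗ (Z ⊗ Y) → Z ⊗ (X ⊗ Y) → (X ⊗ Y) ⊗ Z` of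
`1 ⊗ c_{Z,Y}⁻¹`, `β_{Z,X,Y}⁻¹` and `c_{Z,X ⊗ Y}`. -/
def UnitalBData.α {C : Type u₁} [Category.{v₁} C] (U : UnitalBData C) (X Y Z : C) :
    ten U.tensor X (ten U.tensor Y Z) ≅ ten U.tensor (ten U.tensor X Y) Z :=
  oneTen U.tensor X (U.c Z Y).symm ≪≫ (U.β Z X Y).symm ≪≫ U.c Z (ten U.tensor X Y)

/-- The braided monoidal data obtained from unital b-data, with the same tensor product, unit
object and `ρ`, with associativity constraint `α` (whose inverse is the associator in the
convention of Mathlib), with `λ_X = ρ_X c_{I,X}`, and with braiding `c`. -/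
def UnitalBData.toBraidedMonoidalData {C : Type u₁} [Category.{v₁} C] (U : UnitalBData C) :
    BraidedMonoidalData C where
  monoidalStruct :=
    { tensorObj := fun X Y => ten U.tensor X Y
      whiskerLeft := fun X _ _ f => tenHom U.tensor (𝟙 X) f
      whiskerRight := fun f Y => tenHom U.tensor f (𝟙 Y)
      tensorHom := fun f g => tenHom U.tensor f g
      tensorUnit := U.unit
      associator := fun X Y Z => (U.α X Y Z).symm
      leftUnitor := fun X => U.c U.unit X ≪≫ U.ρ X
      rightUnitor := U.ρ }
  braiding := U.c

end BCat

/-! Read through `c`, the formula for α says that c_{Z,XY} followed by α_{X,Y,Z}⁻¹ equals β_{Z,X,Y}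
followed by 1 ⊗ c_{Z,Y} (`c_tensor_comp_α_inv`). Since c is invertible, statements about α become
statements about β and c. The b-axiom with W = I is a Yang–Baxter identity; in these terms it says
that β is c ⊗ 1 conjugated by α (`β_hom`), and this turns the formula for α into one hexagon.

The unit axioms supply the rest. They make c_{I,X} and c_{X,I} mutually inverse, which gives the
triangle. The first unit axiom with Y = I then gives the other hexagon (`c_tensor_left`), and this
hexagon simplifies the general axiom to `β_tensor_comp`, which is the pentagon written with β.

Conversely, in a braided monoidal category the b-axiom is the Yang–Baxter equation and the unit
axioms are expansions by hexagons. The two passages are inverse by `β_hom` and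
`unitalBDataOfBraided_α_hom`. A functor compatible with β and ρ is compatible with c, because c is β
with last argument I up to ρ; hence it is compatible with α and λ, which are made from β, ρ and c.
-/

namespace BCat

/-! ### Whiskering calculus for a tensor product functor -/

section Whiskering

variable {C : Type u₁} [Category.{v₁} C] (T : C × C ⥤ C)

theorem tenHom_comp {X X' X'' Y Y' Y'' : C} (f : X ⟶ X') (f' : X' ⟶ X'') (g : Y ⟶ Y')
    (g' : Y' ⟶ Y'') : tenHom T (f ≫ f') (g ≫ g') = tenHom T f g ≫ tenHom T f' g' :=
  T.map_comp (Prod.mkHom f g) (Prod.mkHom f' g')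

theorem tenHom_id (X Y : C) : tenHom T (𝟙 X) (𝟙 Y) = 𝟙 (ten T X Y) :=
  T.map_id (X, Y)

/-- Left whiskering `1 ⊗ f` for a tensor product functor. -/
def whiskL (X : C) {Y Y' : C} (f : Y ⟶ Y') : ten T X Y ⟶ ten T X Y' := tenHom T (𝟙 X) f

/-- Right whiskering `f ⊗ 1` for a tensor product functor. -/
def whiskR {X X' : C} (f : X ⟶ X') (Y : C) : ten T X Y ⟶ ten T X' Y := tenHom T f (𝟙 Y)

theorem whiskL_comp (X : C) {Y Y' Y'' : C} (f : Y ⟶ Y') (g : Y' ⟶ Y'') :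
    whiskL T X (f ≫ g) = whiskL T X f ≫ whiskL T X g := by
  simpa only [whiskL, Category.comp_id] using tenHom_comp T (𝟙 X) (𝟙 X) f g

theorem whiskR_comp {X X' X'' : C} (f : X ⟶ X') (g : X' ⟶ X'') (Y : C) :
    whiskR T (f ≫ g) Y = whiskR T f Y ≫ whiskR T g Y := by
  simpa only [whiskR, Category.comp_id] using tenHom_comp T f g (𝟙 Y) (𝟙 Y)

theorem whiskL_comp_assoc (X : C) {Y Y' Y'' Z : C} (f : Y ⟶ Y') (g : Y' ⟶ Y'')
    (h : ten T X Y'' ⟶ Z) : whiskL T X (f ≫ g) ≫ h = whiskL T X f ≫ whiskL T X g ≫ h := by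
  rw [whiskL_comp, Category.assoc]

theorem whiskL_id (X Y : C) : whiskL T X (𝟙 Y) = 𝟙 (ten T X Y) := tenHom_id T X Y

theorem whiskR_id (X Y : C) : whiskR T (𝟙 X) Y = 𝟙 (ten T X Y) := tenHom_id T X Y

theorem tenHom_eq {X X' Y Y' : C} (f : X ⟶ X') (g : Y ⟶ Y') :
    tenHom T f g = whiskR T f Y ≫ whiskL T X' g := by
  simpa only [whiskL, whiskR, Category.comp_id, Category.id_comp] using
    tenHom_comp T f (𝟙 X') (𝟙 Y) g

theorem whisk_exchange {X X' Y Y' : C} (f : X ⟶ X') (g : Y ⟶ Y') :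
    whiskL T X g ≫ whiskR T f Y' = whiskR T f Y ≫ whiskL T X' g := by
  rw [← tenHom_eq]
  simpa only [whiskL, whiskR, Category.comp_id, Category.id_comp] using
    (tenHom_comp T (𝟙 X) f g (𝟙 Y')).symm

theorem whiskL_hom_inv (X : C) {Y Y' : C} (f : Y ≅ Y') :
    whiskL T X f.hom ≫ whiskL T X f.inv = 𝟙 _ := (oneTen T X f).hom_inv_id

theorem whiskL_inv_hom (X : C) {Y Y' : C} (f : Y ≅ Y') :
    whiskL T X f.inv ≫ whiskL T X f.hom = 𝟙 _ := (oneTen T X f).inv_hom_id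

theorem whiskL_hom_inv_assoc (X : C) {Y Y' Z : C} (f : Y ≅ Y') (h : ten T X Y ⟶ Z) :
    whiskL T X f.hom ≫ whiskL T X f.inv ≫ h = h := (oneTen T X f).hom_inv_id_assoc h

theorem whiskL_inv_hom_assoc (X : C) {Y Y' Z : C} (f : Y ≅ Y') (h : ten T X Y' ⟶ Z) :
    whiskL T X f.inv ≫ whiskL T X f.hom ≫ h = h := (oneTen T X f).inv_hom_id_assoc h

theorem whiskL_whiskL_inv_hom_assoc (W X : C) {Y Y' Z : C} (f : Y ≅ Y')
    (h : ten T W (ten T X Y') ⟶ Z) :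
    whiskL T W (whiskL T X f.inv) ≫ whiskL T W (whiskL T X f.hom) ≫ h = h :=
  whiskL_inv_hom_assoc T W (oneTen T X f) h

instance (X : C) {Y Y' : C} (f : Y ⟶ Y') [IsIso f] : IsIso (whiskL T X f) :=
  (oneTen T X (asIso f)).isIso_hom

instance {X X' : C} (f : X ⟶ X') [IsIso f] (Y : C) : IsIso (whiskR T f Y) :=
  ⟨whiskR T (inv f) Y, by rw [← whiskR_comp]; simp [whiskR_id],
    by rw [← whiskR_comp]; simp [whiskR_id]⟩

end Whiskering

/-! ### Coherence of α and c in a unital b-category -/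

namespace UnitalBStructure

variable {C : Type u₁} [Category.{v₁} C] (U : UnitalBStructure C)

local infixr:70 " ⊠ " => ten (BData.tensor (UnitalBData.toBData (toUnitalBData U)))
local infixr:81 " ◃ " => whiskL (BData.tensor (UnitalBData.toBData (toUnitalBData U)))
local notation:81 f:81 " ▹ " Y:82 =>
  whiskR (BData.tensor (UnitalBData.toBData (toUnitalBData U))) f Y

theorem β_naturality₁ {X X' : C} (f : X ⟶ X') (Y Z : C) :
    f ▹ (Y ⊠ Z) ≫ (U.β X' Y Z).hom = (U.β X Y Z).hom ≫ Y ◃ (f ▹ Z) := by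
  simpa only [tenHom_eq, whiskL_id, whiskR_id, Category.comp_id, Category.id_comp] using
    U.isBCategory.β_natural f (𝟙 Y) (𝟙 Z)

theorem β_naturality₂ (X : C) {Y Y' : C} (f : Y ⟶ Y') (Z : C) :
    X ◃ (f ▹ Z) ≫ (U.β X Y' Z).hom = (U.β X Y Z).hom ≫ f ▹ (X ⊠ Z) := by
  simpa only [tenHom_eq, whiskL_id, whiskR_id, Category.comp_id, Category.id_comp] using
    U.isBCategory.β_natural (𝟙 X) f (𝟙 Z)

theorem β_naturality₃ (X Y : C) {Z Z' : C} (f : Z ⟶ Z') :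
    X ◃ (Y ◃ f) ≫ (U.β X Y Z').hom = (U.β X Y Z).hom ≫ Y ◃ (X ◃ f) := by
  simpa only [tenHom_eq, whiskL_id, whiskR_id, Category.comp_id, Category.id_comp] using
    U.isBCategory.β_natural (𝟙 X) (𝟙 Y) f

theorem β_yang_baxter (X Y Z W : C) :
    (U.β X Y (Z ⊠ W)).hom ≫ Y ◃ (U.β X Z W).hom ≫ (U.β Y Z (X ⊠ W)).hom =
      X ◃ (U.β Y Z W).hom ≫ (U.β X Z (Y ⊠ W)).hom ≫ Z ◃ (U.β X Y W).hom :=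
  U.isBCategory.2 X Y Z W

theorem ρ_naturality {X X' : C} (f : X ⟶ X') :
    f ▹ U.unit ≫ (U.ρ X').hom = (U.ρ X).hom ≫ f := U.isUnital.ρ_natural f

theorem ρ_inv_naturality {X X' : C} (f : X ⟶ X') :
    (U.ρ X).inv ≫ f ▹ U.unit = f ≫ (U.ρ X').inv := by
  rw [Iso.inv_comp_eq, ← Category.assoc, ← ρ_naturality, Category.assoc, Iso.hom_inv_id,
    Category.comp_id]

theorem ρ_tensor_unit (X : C) : (U.ρ (X ⊠ U.unit)).hom = (U.ρ X).hom ▹ U.unit := by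
  rw [← cancel_mono (U.ρ X).hom, ρ_naturality]

theorem unit_axiom₁ (X Y Z W : C) :
    (U.c (X ⊠ Y) (Z ⊠ W)).hom ≫ (U.β (Z ⊠ W) X Y).hom ≫ X ◃ (U.c (Z ⊠ W) Y).hom =
      (U.β (X ⊠ Y) Z W).hom ≫ Z ◃ (U.c (X ⊠ Y) W).hom ≫ Z ◃ (U.β W X Y).hom ≫
        (U.β Z X (W ⊠ Y)).hom ≫ X ◃ (Z ◃ (U.c W Y).hom) ≫ X ◃ (U.β Z Y W).hom :=
  U.isUnital.unit_axiom₁ X Y Z W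

theorem unit_axiom₂ (X Y : C) :
    X ◃ (U.c Y U.unit).hom ≫ (U.β X U.unit Y).hom =
      X ◃ (U.ρ Y).hom ≫ (U.ρ (X ⊠ Y)).inv ≫ (U.c (X ⊠ Y) U.unit).hom :=
  U.isUnital.unit_axiom₂ X Y

theorem c_hom (X Y : C) : (U.c X Y).hom =
    X ◃ (U.ρ Y).inv ≫ (U.β X Y U.unit).hom ≫ Y ◃ (U.ρ X).hom := rfl

theorem β_unit_hom (X Y : C) : (U.β X Y U.unit).hom =
    X ◃ (U.ρ Y).hom ≫ (U.c X Y).hom ≫ Y ◃ (U.ρ X).inv := by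
  simp only [c_hom, Category.assoc, whiskL_hom_inv, whiskL_hom_inv_assoc, Category.comp_id]

theorem c_naturality_left {X X' : C} (f : X ⟶ X') (Y : C) :
    f ▹ Y ≫ (U.c X' Y).hom = (U.c X Y).hom ≫ Y ◃ f := by
  simp only [c_hom, Category.assoc]
  rw [← reassoc_of% (whisk_exchange U.tensor f),
    reassoc_of% (U.β_naturality₁ f), ← whiskL_comp, ρ_naturality, whiskL_comp]

theorem c_naturality_right (X : C) {Y Y' : C} (f : Y ⟶ Y') :
    X ◃ f ≫ (U.c X Y').hom = (U.c X Y).hom ≫ f ▹ X := by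
  simp only [c_hom, Category.assoc]
  rw [← Category.assoc, ← whiskL_comp, ← ρ_inv_naturality, whiskL_comp, Category.assoc,
    reassoc_of% (U.β_naturality₂), ← whisk_exchange]

theorem α_inv (X Y Z : C) : (U.α X Y Z).inv =
    (U.c Z (X ⊠ Y)).inv ≫ (U.β Z X Y).hom ≫ X ◃ (U.c Z Y).hom := by
  simp only [UnitalBData.α, Iso.trans_inv, Iso.symm_inv, Category.assoc]; rfl

theorem c_tensor_comp_α_inv (X Y Z : C) : (U.c Z (X ⊠ Y)).hom ≫ (U.α X Y Z).inv =
    (U.β Z X Y).hom ≫ X ◃ (U.c Z Y).hom := by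
  rw [α_inv, Iso.hom_inv_id_assoc]

/-- The b-axiom with last argument the unit, rewritten in terms of `c`. -/
theorem β_yang_baxter_c (X Y Z : C) :
    (U.β X Y Z).hom ≫ Y ◃ (U.c X Z).hom ≫ (U.β Y Z X).hom =
      X ◃ (U.c Y Z).hom ≫ (U.β X Z Y).hom ≫ Z ◃ (U.c X Y).hom := by
  have h := U.β_yang_baxter X Y Z U.unit
  simp only [β_unit_hom, whiskL_comp, Category.assoc] at h
  -- By naturality of β in its last variable, ρ_Z moves to the front, ρ_X⁻¹ to the end, and the ρ_Y
  -- pair cancels.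
  rw [← reassoc_of% (U.β_naturality₃ X Y (U.ρ Z).hom), U.β_naturality₃ Y Z (U.ρ X).inv,
    reassoc_of% (U.β_naturality₃ X Z (U.ρ Y).inv), whiskL_whiskL_inv_hom_assoc, cancel_epi] at h
  simpa only [← Category.assoc, cancel_mono] using h

/-- The isomorphism `β` is the conjugate of `c ⊗ 1` by associativity constraints. -/
theorem β_hom (X Y Z : C) : (U.β X Y Z).hom =
    (U.α X Y Z).hom ≫ (U.c X Y).hom ▹ Z ≫ (U.α Y X Z).inv := by
  -- Precomposing with c_{Z,XY} replaces each α⁻¹ by β and c, and leaves `β_yang_baxter_c` for the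
  -- triple Z, X, Y.
  rw [← Iso.inv_comp_eq, ← cancel_epi (U.c Z (X ⊠ Y)).hom,
    reassoc_of% (U.c_tensor_comp_α_inv X Y Z), ← reassoc_of% (U.c_naturality_right Z),
    c_tensor_comp_α_inv, β_yang_baxter_c]

/-- The isomorphisms ρ_X c_{I,X} are natural, so I ⊗ − is isomorphic to the identity functor and
hence faithful. -/
theorem unit_whiskL_injective {X Y : C} {f g : X ⟶ Y} (h : U.unit ◃ f = U.unit ◃ g) : f = g := by
  have key (k : X ⟶ Y) : U.unit ◃ k ≫ (U.c U.unit Y).hom ≫ (U.ρ Y).hom =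
      (U.c U.unit X).hom ≫ (U.ρ X).hom ≫ k := by
    rw [reassoc_of% (U.c_naturality_right U.unit k), ρ_naturality]
  simpa only [key, cancel_epi] using congrArg (· ≫ (U.c U.unit Y).hom ≫ (U.ρ Y).hom) h

/-- With W = I, the first unit axiom reduces by naturality and cancellation to 1_Z ⊗ k = 1 for every
Z, where k is the composite in question. Faithfulness of I ⊗ − then gives k = 1. -/
theorem unit_axiom₁_unit (X Y : C) :
    (U.ρ (X ⊠ Y)).inv ≫ (U.c (X ⊠ Y) U.unit).hom ≫ (U.β U.unit X Y).hom ≫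
      X ◃ (U.c U.unit Y).hom ≫ X ◃ (U.ρ Y).hom = 𝟙 _ := by
  have key (Z : C) : Z ◃ ((U.ρ (X ⊠ Y)).inv ≫ (U.c (X ⊠ Y) U.unit).hom ≫ (U.β U.unit X Y).hom ≫
      X ◃ (U.c U.unit Y).hom ≫ X ◃ (U.ρ Y).hom) = 𝟙 _ := by
    have h := U.unit_axiom₁ X Y Z U.unit
    rw [U.β_unit_hom (X ⊠ Y) Z, ← cancel_epi ((X ⊠ Y) ◃ (U.ρ Z).inv),
      reassoc_of% (U.c_naturality_right (X ⊠ Y) (U.ρ Z).inv),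
      reassoc_of% (U.β_naturality₁ (U.ρ Z).inv), ← whiskL_comp, U.c_naturality_left,
      U.β_unit_hom Z Y] at h
    simp only [Category.assoc, whiskL_inv_hom_assoc, whiskL_comp] at h
    rw [← reassoc_of% (U.β_naturality₃ Z X (U.c U.unit Y).hom),
      ← reassoc_of% (U.β_naturality₃ Z X (U.ρ Y).hom), cancel_epi] at h
    rw [← cancel_mono (U.β Z X Y).hom, ← cancel_mono (X ◃ (U.c Z Y).hom),
      ← cancel_mono (X ◃ (Y ◃ (U.ρ Z).inv)), Category.id_comp]
    simp only [whiskL_comp, Category.assoc]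
    exact h.symm
  apply U.unit_whiskL_injective
  rw [key, whiskL_id]

theorem β_unit_left (X Y : C) : (U.β U.unit X Y).hom ≫ X ◃ (U.c U.unit Y).hom =
    (U.c (X ⊠ Y) U.unit).inv ≫ (U.ρ (X ⊠ Y)).hom ≫ X ◃ (U.ρ Y).inv := by
  rw [Iso.eq_inv_comp, ← Iso.inv_comp_eq, ← cancel_mono (X ◃ (U.ρ Y).hom)]
  simpa only [Category.assoc, whiskL_inv_hom] using U.unit_axiom₁_unit X Y

theorem c_tensor_unit (X : C) : (U.c (X ⊠ U.unit) U.unit).hom =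
    (U.ρ X).hom ▹ U.unit ≫ (U.c X U.unit).hom ≫ U.unit ◃ (U.ρ X).inv := by
  rw [reassoc_of% (U.c_naturality_left (U.ρ X).hom), whiskL_hom_inv, Category.comp_id]

/-- The braiding of the unit with itself is trivial. -/
theorem c_unit_unit : (U.c U.unit U.unit).hom = 𝟙 _ := by
  have h := U.unit_axiom₂ U.unit U.unit
  -- At X = Y = I the right side of the axiom is β_{I,I,I} itself; cancelling it leaves 1 ⊗ c_{I,I}
  -- = 1.
  rw [β_unit_hom, c_tensor_unit, ← ρ_tensor_unit, Iso.inv_hom_id_assoc] at h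
  apply U.unit_whiskL_injective
  rwa [← cancel_mono (U.unit ◃ (U.ρ U.unit).hom ≫ (U.c U.unit U.unit).hom ≫
    U.unit ◃ (U.ρ U.unit).inv), whiskL_id, Category.id_comp]

/-- This is `β_unit_left` at Y = I: there c_{I,I} is trivial, and c_{XI,I} and β_{I,X,I} are c_{X,I}
and c_{I,X} up to ρ. -/
theorem c_unit_comp_c (X : C) : (U.c X U.unit).hom ≫ (U.c U.unit X).hom = 𝟙 _ := by
  have h := U.β_unit_left X U.unit
  rw [c_unit_unit, whiskL_id, Category.comp_id, β_unit_hom, Iso.eq_inv_comp, c_tensor_unit,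
    ρ_tensor_unit] at h
  simp only [Category.assoc, whiskL_inv_hom_assoc] at h
  simpa only [← Category.assoc, cancel_mono, Category.comp_id] using
    (cancel_epi ((U.ρ X).hom ▹ U.unit)).1 ((by simpa only [← Category.assoc, cancel_mono] using h :
      _ = _).trans (Category.comp_id _).symm)

theorem triangle (X Y : C) :
    (U.α X U.unit Y).inv ≫ X ◃ ((U.c U.unit Y).hom ≫ (U.ρ Y).hom) = (U.ρ X).hom ▹ Y := by
  rw [α_inv, β_unit_hom]
  simp only [Category.assoc, ← whiskL_comp]
  rw [reassoc_of% (U.c_unit_comp_c Y), Iso.inv_hom_id, whiskL_id, Category.comp_id,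
    Iso.inv_comp_eq, c_naturality_right]

/-- For each variable, precomposing with the invertible c_{Z,XY} reduces naturality of α⁻¹ to that
of β and c. -/
theorem α_inv_naturality_left {X X' : C} (f : X ⟶ X') (Y Z : C) :
    f ▹ Y ▹ Z ≫ (U.α X' Y Z).inv = (U.α X Y Z).inv ≫ f ▹ (Y ⊠ Z) := by
  rw [← cancel_epi (U.c Z (X ⊠ Y)).hom, ← reassoc_of% (U.c_naturality_right Z),
    c_tensor_comp_α_inv, reassoc_of% (U.β_naturality₂ Z f), ← whisk_exchange,
    reassoc_of% (U.c_tensor_comp_α_inv X Y Z)]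

theorem α_inv_naturality_middle (X : C) {Y Y' : C} (f : Y ⟶ Y') (Z : C) :
    (X ◃ f) ▹ Z ≫ (U.α X Y' Z).inv = (U.α X Y Z).inv ≫ X ◃ (f ▹ Z) := by
  rw [← cancel_epi (U.c Z (X ⊠ Y)).hom, ← reassoc_of% (U.c_naturality_right Z),
    c_tensor_comp_α_inv, reassoc_of% (U.β_naturality₃ Z X f), ← whiskL_comp,
    c_naturality_right, whiskL_comp, reassoc_of% (U.c_tensor_comp_α_inv X Y Z)]

theorem α_inv_naturality_right (X Y : C) {Z Z' : C} (f : Z ⟶ Z') :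
    (X ⊠ Y) ◃ f ≫ (U.α X Y Z').inv = (U.α X Y Z).inv ≫ X ◃ (Y ◃ f) := by
  rw [← cancel_epi (U.c Z (X ⊠ Y)).hom, ← reassoc_of% (U.c_naturality_left f),
    c_tensor_comp_α_inv, reassoc_of% (U.β_naturality₁ f), ← whiskL_comp,
    c_naturality_left, whiskL_comp, reassoc_of% (U.c_tensor_comp_α_inv X Y Z)]

/-- The first unit axiom after cancellation of `c_{XY,ZW}`. -/
theorem α_hom_comp_c (X Y Z W : C) :
    (U.α Z W (X ⊠ Y)).hom ≫ (U.c (Z ⊠ W) (X ⊠ Y)).hom ≫ (U.α X Y (Z ⊠ W)).inv =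
      Z ◃ (U.β W X Y).hom ≫ (U.β Z X (W ⊠ Y)).hom ≫ X ◃ (Z ◃ (U.c W Y).hom) ≫
        X ◃ (U.β Z Y W).hom := by
  rw [← Iso.eq_inv_comp, ← cancel_epi (U.c (X ⊠ Y) (Z ⊠ W)).hom, c_tensor_comp_α_inv,
    unit_axiom₁, reassoc_of% (U.c_tensor_comp_α_inv Z W (X ⊠ Y))]

/-- A hexagon identity, with `β` in place of one of its sides. -/
theorem c_tensor_left (X Y Z : C) :
    (U.α X Y Z).hom ≫ (U.c (X ⊠ Y) Z).hom = X ◃ (U.c Y Z).hom ≫ (U.β X Z Y).hom := by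
  -- The unit in second place lets the triangle absorb the α⁻¹ on the left and `unit_axiom₂` the
  -- last β on the right, once both sides are followed by 1_Z ⊗ λ_{XY}.
  have h := U.α_hom_comp_c Z U.unit X Y
  rw [← whiskL_comp, unit_axiom₂, ← cancel_mono (Z ◃ ((U.c U.unit (X ⊠ Y)).hom ≫
    (U.ρ (X ⊠ Y)).hom))] at h
  simp only [Category.assoc] at h
  rw [triangle, ← whiskL_comp] at h
  simp only [Category.assoc] at h
  rw [reassoc_of% (U.c_unit_comp_c (X ⊠ Y)), Iso.inv_hom_id, Category.comp_id,
    ← U.β_naturality₃, ← whiskL_comp_assoc, β_unit_hom, ← c_naturality_right] at h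
  simp only [Category.assoc, whiskL_inv_hom, Category.comp_id] at h
  have h' := U.α_inv_naturality_right X Y (U.ρ Z).hom
  rw [Iso.eq_inv_comp, ← Category.assoc, Iso.comp_inv_eq] at h'
  rw [reassoc_of% h', whiskL_comp_assoc, cancel_epi] at h
  exact h

/-- Substituting the hexagon `c_tensor_left` into `α_hom_comp_c` makes 1_Z ⊗ c_{W,XY} a common first
factor, which cancels. -/
theorem β_tensor_comp (X Y Z W : C) :
    (U.β Z (X ⊠ Y) W).hom ≫ (U.α X Y (Z ⊠ W)).inv =
      Z ◃ (U.α X Y W).inv ≫ (U.β Z X (Y ⊠ W)).hom ≫ X ◃ (U.β Z Y W).hom := by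
  have h := U.α_hom_comp_c X Y Z W
  rw [reassoc_of% (U.c_tensor_left Z W (X ⊠ Y)), ← reassoc_of% (U.β_naturality₃ Z X),
    ← whiskL_comp_assoc, ← c_tensor_comp_α_inv, whiskL_comp_assoc, cancel_epi] at h
  exact h

theorem pentagon (X Y Z W : C) :
    (U.α X Y Z).inv ▹ W ≫ (U.α X (Y ⊠ Z) W).inv ≫ X ◃ (U.α Y Z W).inv =
      (U.α (X ⊠ Y) Z W).inv ≫ (U.α X Y (Z ⊠ W)).inv := by
  have h := U.β_tensor_comp X Y W Z
  have hβ (X Y Z : C) : (U.β Z X Y).hom =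
      (U.c Z (X ⊠ Y)).hom ≫ (U.α X Y Z).inv ≫ X ◃ (U.c Z Y).inv := by
    rw [reassoc_of% (U.c_tensor_comp_α_inv X Y Z), whiskL_hom_inv, Category.comp_id]
  -- With each β expanded into c and α⁻¹, every crossing cancels against another or is a common end
  -- factor.
  simp only [hβ, Category.assoc, whiskL_comp, whiskL_inv_hom_assoc] at h
  rw [U.α_inv_naturality_right, reassoc_of% (U.c_naturality_right W), cancel_epi] at h
  simpa only [← Category.assoc, cancel_mono] using h.symm

end UnitalBStructure

/-! ### From braided monoidal categories to unital b-categories -/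

open MonoidalCategory BraidedCategory

theorem oneTen_tensor_hom {C : Type u₁} [Category.{v₁} C] [MonoidalCategory C] (X : C) {Y Y' : C}
    (f : Y ≅ Y') : (oneTen (tensor C) X f).hom = X ◁ f.hom := id_tensorHom X f.hom

/-- The fields replaced here are those that the round trip returns only up to a propositional
equality; the others return definitionally. -/
theorem BraidedMonoidalData.mk_eq_mk {C : Type u₁} [Category.{v₁} C] (M : MonoidalCategoryStruct C)
    (b : ∀ X Y : C, X ⊗ Y ≅ Y ⊗ X) {wl : ∀ (X : C) {Y Y' : C} (_ : Y ⟶ Y'), X ⊗ Y ⟶ X ⊗ Y'}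
    {wr : ∀ {X X' : C} (_ : X ⟶ X') (Y : C), X ⊗ Y ⟶ X' ⊗ Y}
    {a : ∀ X Y Z : C, (X ⊗ Y) ⊗ Z ≅ X ⊗ (Y ⊗ Z)} {l : ∀ X : C, 𝟙_ C ⊗ X ≅ X}
    {b' : ∀ X Y : C, X ⊗ Y ≅ Y ⊗ X}
    (hwl : ∀ (X : C) {Y Y' : C} (f : Y ⟶ Y'), wl X f = X ◁ f)
    (hwr : ∀ {X X' : C} (f : X ⟶ X') (Y : C), wr f Y = f ▷ Y)
    (ha : ∀ X Y Z : C, a X Y Z = α_ X Y Z) (hl : ∀ X : C, l X = λ_ X)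
    (hb : ∀ X Y : C, b' X Y = b X Y) :
    (⟨{ M with whiskerLeft := wl, whiskerRight := wr, associator := a, leftUnitor := l }, b'⟩ :
      BraidedMonoidalData C) = ⟨M, b⟩ := by
  obtain rfl : a = M.associator := by funext X Y Z; exact ha X Y Z
  obtain rfl : l = M.leftUnitor := by funext X; exact hl X
  obtain rfl : b' = b := by funext X Y; exact hb X Y
  obtain rfl : @wl = @M.whiskerLeft := by funext X Y Y' f; exact hwl X f
  obtain rfl : @wr = @M.whiskerRight := by funext X X' f Y; exact hwr f Y
  rfl

section

variable (C : Type u₁) [Category.{v₁} C] [MonoidalCategory C] [BraidedCategory C]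

theorem unitalBDataOfBraided_β_hom (X Y Z : C) : ((unitalBDataOfBraided C).β X Y Z).hom =
    (α_ X Y Z).inv ≫ (β_ X Y).hom ▷ Z ≫ (α_ Y X Z).hom := rfl

theorem unitalBDataOfBraided_c (X Y : C) : (unitalBDataOfBraided C).c X Y = β_ X Y := by
  ext
  change (𝟙 X ⊗ₘ (ρ_ Y).inv) ≫ ((α_ X Y (𝟙_ C)).inv ≫ (β_ X Y).hom ▷ (𝟙_ C) ≫
    (α_ Y X (𝟙_ C)).hom) ≫ (𝟙 Y ⊗ₘ (ρ_ X).hom) = _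
  simp

theorem unitalBDataOfBraided_isBCategory : (unitalBDataOfBraided C).IsBCategory where
  β_natural {X X' Y Y' Z Z'} f g h := by
    change (f ⊗ₘ (g ⊗ₘ h)) ≫ (α_ X' Y' Z').inv ≫ (β_ X' Y').hom ▷ Z' ≫ (α_ Y' X' Z').hom =
      ((α_ X Y Z).inv ≫ (β_ X Y).hom ▷ Z ≫ (α_ Y X Z).hom) ≫ (g ⊗ₘ (f ⊗ₘ h))
    rw [associator_inv_naturality_assoc, Category.assoc, Category.assoc, ← associator_naturality,
      ← tensorHom_id, ← tensorHom_id, tensorHom_comp_tensorHom_assoc, tensorHom_comp_tensorHom_assoc,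
      braiding_naturality, Category.id_comp, Category.comp_id]
  b_axiom X Y Z W := by
    -- The b-axiom is the Yang–Baxter equation for X, Y, Z, tensored with W and reassociated.
    have h := congrArg (fun k => X ◁ (α_ Y Z W).inv ≫ (α_ X (Y ⊗ Z) W).inv ≫ k ▷ W ≫
      (α_ Z (Y ⊗ X) W).hom ≫ Z ◁ (α_ Y X W).hom) (yang_baxter X Y Z)
    change ((α_ X Y (Z ⊗ W)).inv ≫ (β_ X Y).hom ▷ (Z ⊗ W) ≫ (α_ Y X (Z ⊗ W)).hom) ≫
      (oneTen (tensor C) Y ((unitalBDataOfBraided C).β X Z W)).hom ≫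
      ((α_ Y Z (X ⊗ W)).inv ≫ (β_ Y Z).hom ▷ (X ⊗ W) ≫ (α_ Z Y (X ⊗ W)).hom) =
      (oneTen (tensor C) X ((unitalBDataOfBraided C).β Y Z W)).hom ≫
      ((α_ X Z (Y ⊗ W)).inv ≫ (β_ X Z).hom ▷ (Y ⊗ W) ≫ (α_ Z X (Y ⊗ W)).hom) ≫
      (oneTen (tensor C) Z ((unitalBDataOfBraided C).β X Y W)).hom
    rw [oneTen_tensor_hom, oneTen_tensor_hom, oneTen_tensor_hom]
    simp only [unitalBDataOfBraided_β_hom]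
    trans
    · trans
      swap
      · exact h
      · monoidal
    · monoidal

theorem unitalBDataOfBraided_isUnital : (unitalBDataOfBraided C).IsUnital where
  ρ_natural {X X'} f := by
    change (f ⊗ₘ 𝟙 (𝟙_ C)) ≫ (ρ_ X').hom = (ρ_ X).hom ≫ f
    rw [tensorHom_id, rightUnitor_naturality]
  unit_axiom₁ X Y Z W := by
    simp only [unitalBDataOfBraided_c]
    change (β_ (X ⊗ Y) (Z ⊗ W)).hom ≫
      ((α_ (Z ⊗ W) X Y).inv ≫ (β_ (Z ⊗ W) X).hom ▷ Y ≫ (α_ X (Z ⊗ W) Y).hom) ≫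
      (oneTen (tensor C) X (β_ (Z ⊗ W) Y)).hom =
      ((α_ (X ⊗ Y) Z W).inv ≫ (β_ (X ⊗ Y) Z).hom ▷ W ≫ (α_ Z (X ⊗ Y) W).hom) ≫
      (oneTen (tensor C) Z (β_ (X ⊗ Y) W)).hom ≫
      (oneTen (tensor C) Z ((unitalBDataOfBraided C).β W X Y)).hom ≫
      ((α_ Z X (W ⊗ Y)).inv ≫ (β_ Z X).hom ▷ (W ⊗ Y) ≫ (α_ X Z (W ⊗ Y)).hom) ≫
      (oneTen (tensor C) X (oneTen (tensor C) Z (β_ W Y))).hom ≫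
      (oneTen (tensor C) X ((unitalBDataOfBraided C).β Z Y W)).hom
    simp only [oneTen_tensor_hom, unitalBDataOfBraided_β_hom]
    -- After these hexagons both sides have the same crossings in the same order, so only
    -- associators differ.
    rw [braiding_tensor_right_hom (X ⊗ Y) Z W, braiding_tensor_left_hom Z W X,
      braiding_tensor_left_hom Z W Y]
    monoidal
  unit_axiom₂ X Y := by
    simp only [unitalBDataOfBraided_c]
    change (oneTen (tensor C) X (β_ Y (𝟙_ C))).hom ≫
      (α_ X (𝟙_ C) Y).inv ≫ (β_ X (𝟙_ C)).hom ▷ Y ≫ (α_ (𝟙_ C) X Y).hom =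
      (oneTen (tensor C) X (ρ_ Y)).hom ≫ (ρ_ (X ⊗ Y)).inv ≫ (β_ (X ⊗ Y) (𝟙_ C)).hom
    rw [oneTen_tensor_hom, oneTen_tensor_hom, braiding_tensor_left_hom]
    monoidal

/-- The unital b-category structure of a braided monoidal category. -/
def unitalBStructureOfBraided : UnitalBStructure C where
  toUnitalBData := unitalBDataOfBraided C
  isBCategory := unitalBDataOfBraided_isBCategory C
  isUnital := unitalBDataOfBraided_isUnital C

theorem unitalBDataOfBraided_β_inv (X Y Z : C) : ((unitalBDataOfBraided C).β X Y Z).inv =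
    (α_ Y X Z).inv ≫ (β_ X Y).inv ▷ Z ≫ (α_ X Y Z).hom := by
  simp only [unitalBDataOfBraided, Iso.trans_inv, whiskerRightIso_inv, Iso.symm_inv,
    Category.assoc]

theorem unitalBDataOfBraided_α_hom (X Y Z : C) :
    ((unitalBDataOfBraided C).α X Y Z).hom = (α_ X Y Z).inv := by
  simp only [UnitalBData.α, unitalBDataOfBraided_c]
  change (oneTen (tensor C) X (β_ Z Y).symm).hom ≫ ((unitalBDataOfBraided C).β Z X Y).inv ≫
    (β_ Z (X ⊗ Y)).hom = _
  rw [unitalBDataOfBraided_β_inv, oneTen_tensor_hom, braiding_tensor_right_hom]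
  change X ◁ (β_ Z Y).inv ≫ ((α_ X Z Y).inv ≫ (β_ Z X).inv ▷ Y ≫ (α_ Z X Y).hom) ≫
    (α_ Z X Y).inv ≫ (β_ Z X).hom ▷ Y ≫ (α_ X Z Y).hom ≫ X ◁ (β_ Z Y).hom ≫ (α_ X Y Z).inv = _
  simp

theorem unitalBDataOfBraided_toBraidedMonoidalData :
    (unitalBDataOfBraided C).toBraidedMonoidalData =
      (⟨inferInstance, inferInstance⟩ : BraidedMonoidalStructure C).toData :=
  BraidedMonoidalData.mk_eq_mk _ _ (fun X _ _ f => id_tensorHom X f)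
    (fun f Y => tensorHom_id f Y)
    (fun X Y Z => Iso.ext ((Iso.inv_eq_inv _ (α_ X Y Z).symm).2
      (unitalBDataOfBraided_α_hom C X Y Z)))
    (fun X => by
      rw [unitalBDataOfBraided_c]
      exact Iso.ext (braiding_rightUnitor X))
    (fun X Y => unitalBDataOfBraided_c C X Y)

/-- The double β is the double braiding tensored with Z and conjugated by α. For the forward
direction Z is the unit, since − ⊗ I is faithful. -/
theorem unitalBDataOfBraided_isSymmetric_iff :
    (unitalBDataOfBraided C).IsSymmetric ↔ ∀ X Y : C, (β_ X Y).hom ≫ (β_ Y X).hom = 𝟙 _ := by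
  have key (X Y Z : C) : ((unitalBDataOfBraided C).β Y X Z).hom ≫
      ((unitalBDataOfBraided C).β X Y Z).hom =
        (α_ Y X Z).inv ≫ ((β_ Y X).hom ≫ (β_ X Y).hom) ▷ Z ≫ (α_ Y X Z).hom := by
    change ((α_ Y X Z).inv ≫ (β_ Y X).hom ▷ Z ≫ (α_ X Y Z).hom) ≫
      (α_ X Y Z).inv ≫ (β_ X Y).hom ▷ Z ≫ (α_ Y X Z).hom = _
    simp
  refine ⟨fun h X Y => ?_, fun h X Y Z => ?_⟩
  · have h' : (α_ X Y (𝟙_ C)).inv ≫ ((β_ X Y).hom ≫ (β_ Y X).hom) ▷ 𝟙_ C ≫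
        (α_ X Y (𝟙_ C)).hom = 𝟙 _ := (key Y X (𝟙_ C)).symm.trans (h Y X (𝟙_ C))
    rwa [Iso.inv_comp_eq, Category.comp_id, ← Iso.eq_comp_inv, Iso.hom_inv_id,
      ← id_whiskerRight, whiskerRight_iff] at h'
  · refine (key X Y Z).trans ?_
    rw [h, id_whiskerRight, Category.id_comp]
    exact (α_ Y X Z).inv_hom_id

end

/-! ### The bijection between structures -/

theorem BraidedMonoidalStructure.toData_injective {C : Type u₁} [Category.{v₁} C] :
    Function.Injective (BraidedMonoidalStructure.toData (C := C)) := by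
  rintro ⟨⟨⟩, ⟨⟩⟩ ⟨⟨⟩, ⟨⟩⟩ h
  simp only [BraidedMonoidalStructure.toData, BraidedMonoidalData.mk.injEq] at h
  obtain ⟨rfl, h⟩ := h
  cases eq_of_heq h
  rfl

namespace UnitalBStructure

variable {C : Type u₁} [Category.{v₁} C] (U : UnitalBStructure C)

/-- The monoidal structure of a unital b-category. -/
abbrev toMonoidalCategory : MonoidalCategory C where
  toMonoidalCategoryStruct := U.toBraidedMonoidalData.monoidalStruct
  tensorHom_def := tenHom_eq U.tensor
  id_tensorHom_id := tenHom_id U.tensor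
  tensorHom_comp_tensorHom f₁ f₂ g₁ g₂ := (tenHom_comp U.tensor f₁ g₁ f₂ g₂).symm
  whiskerLeft_id := whiskL_id U.tensor
  id_whiskerRight := whiskR_id U.tensor
  associator_naturality {X₁ X₂ X₃ Y₁ Y₂ Y₃} f g h := by
    change tenHom U.tensor (tenHom U.tensor f g) h ≫ (U.α Y₁ Y₂ Y₃).inv =
      (U.α X₁ X₂ X₃).inv ≫ tenHom U.tensor f (tenHom U.tensor g h)
    simp only [tenHom_eq, whiskL_comp, whiskR_comp, Category.assoc, α_inv_naturality_right]
    rw [reassoc_of% (U.α_inv_naturality_middle), reassoc_of% (U.α_inv_naturality_left)]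
  leftUnitor_naturality {X Y} f := by
    change whiskL U.tensor U.unit f ≫ (U.c U.unit Y).hom ≫ (U.ρ Y).hom =
      ((U.c U.unit X).hom ≫ (U.ρ X).hom) ≫ f
    rw [reassoc_of% (U.c_naturality_right U.unit f), ρ_naturality, Category.assoc]
  rightUnitor_naturality := U.ρ_naturality
  pentagon := U.pentagon
  triangle := U.triangle

/-- The braiding of a unital b-category. -/
abbrev toBraidedCategory : @BraidedCategory C _ U.toMonoidalCategory :=
  letI := U.toMonoidalCategory
  { braiding := U.c
    braiding_naturality_left := U.c_naturality_left
    braiding_naturality_right := U.c_naturality_right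
    hexagon_forward := fun X Y Z => by
      change (U.α X Y Z).inv ≫ (U.c X (ten U.tensor Y Z)).hom ≫ (U.α Y Z X).inv =
        whiskR U.tensor (U.c X Y).hom Z ≫ (U.α Y X Z).inv ≫ whiskL U.tensor Y (U.c X Z).hom
      rw [c_tensor_comp_α_inv, β_hom]
      simp only [Category.assoc, Iso.inv_hom_id_assoc]
    hexagon_reverse := fun X Y Z => by
      change (U.α X Y Z).hom ≫ (U.c (ten U.tensor X Y) Z).hom ≫ (U.α Z X Y).hom =
        whiskL U.tensor X (U.c Y Z).hom ≫ (U.α X Z Y).hom ≫ whiskR U.tensor (U.c X Z).hom Y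
      rw [reassoc_of% (U.c_tensor_left X Y Z), β_hom]
      simp only [Category.assoc, Iso.inv_hom_id, Category.comp_id] }

/-- The braided monoidal structure of a unital b-category. -/
def toBraidedMonoidalStructure : BraidedMonoidalStructure C where
  monoidal := U.toMonoidalCategory
  braided := U.toBraidedCategory

theorem toBraidedMonoidalStructure_toData :
    U.toBraidedMonoidalStructure.toData = U.toBraidedMonoidalData := rfl

theorem toUnitalBData_injective :
    Function.Injective (UnitalBStructure.toUnitalBData (C := C)) := by
  rintro ⟨⟩ ⟨⟩ rfl
  rfl

theorem toBraidedMonoidalStructure_toUnitalBData :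
    U.toBraidedMonoidalStructure.toUnitalBData = U.toUnitalBData := by
  have h : U.toBraidedMonoidalStructure.toUnitalBData.β = U.β := by
    funext X Y Z
    exact Iso.ext (U.β_hom X Y Z).symm
  exact congrArg (fun β => (⟨⟨U.tensor, β⟩, U.unit, U.ρ⟩ : UnitalBData C)) h

end UnitalBStructure

/-- The unital b-category structure of a braided monoidal structure. -/
def BraidedMonoidalStructure.toUnitalBStructure {C : Type u₁} [Category.{v₁} C]
    (B : BraidedMonoidalStructure C) : UnitalBStructure C :=
  @unitalBStructureOfBraided C _ B.monoidal B.braided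

/-- Unital b-category structures are equivalent to braided monoidal structures. -/
def unitalBStructureEquiv (C : Type u₁) [Category.{v₁} C] :
    UnitalBStructure C ≃ BraidedMonoidalStructure C where
  toFun := UnitalBStructure.toBraidedMonoidalStructure
  invFun := BraidedMonoidalStructure.toUnitalBStructure
  left_inv U := UnitalBStructure.toUnitalBData_injective
    U.toBraidedMonoidalStructure_toUnitalBData
  right_inv B := BraidedMonoidalStructure.toData_injective
    (@unitalBDataOfBraided_toBraidedMonoidalData C _ B.monoidal B.braided)

/-! ### The symmetric case -/

theorem SymmetricMonoidalStructure.toBraided_injective {C : Type u₁} [Category.{v₁} C] :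
    Function.Injective (SymmetricMonoidalStructure.toBraided (C := C)) := by
  rintro ⟨M, ⟨⟩⟩ ⟨M', ⟨⟩⟩ h
  simp only [SymmetricMonoidalStructure.toBraided, BraidedMonoidalStructure.mk.injEq] at h
  obtain ⟨rfl, h⟩ := h
  cases eq_of_heq h
  rfl

theorem BraidedMonoidalStructure.isSymmetric_iff {C : Type u₁} [Category.{v₁} C]
    (B : BraidedMonoidalStructure C) : B.toUnitalBData.IsSymmetric ↔
      B ∈ Set.range SymmetricMonoidalStructure.toBraided := by
  refine (@unitalBDataOfBraided_isSymmetric_iff C _ B.monoidal B.braided).trans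
    ⟨fun h => ⟨⟨B.monoidal, @SymmetricCategory.mk C _ B.monoidal B.braided h⟩, rfl⟩, ?_⟩
  rintro ⟨S, rfl⟩
  exact S.symmetric.symmetry

/-- Symmetric unital b-category structures are equivalent to symmetric monoidal structures. -/
noncomputable def symmetricUnitalBStructureEquiv (C : Type u₁) [Category.{v₁} C] :
    {U : UnitalBStructure C // U.toBData.IsSymmetric} ≃ SymmetricMonoidalStructure C :=
  ((unitalBStructureEquiv C).subtypeEquiv fun U => by
    rw [← BraidedMonoidalStructure.isSymmetric_iff]
    change _ ↔ U.toBraidedMonoidalStructure.toUnitalBData.toBData.IsSymmetric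
    rw [U.toBraidedMonoidalStructure_toUnitalBData]).trans
  (Equiv.ofInjective _ SymmetricMonoidalStructure.toBraided_injective).symm

theorem symmetricUnitalBStructureEquiv_toBraided {C : Type u₁} [Category.{v₁} C]
    (U : {U : UnitalBStructure C // U.toBData.IsSymmetric}) :
    (symmetricUnitalBStructureEquiv C U).toBraided = unitalBStructureEquiv C U.1 :=
  Equiv.apply_ofInjective_symm SymmetricMonoidalStructure.toBraided_injective _

/-! ### Unital b-functors and braided monoidal functors -/

theorem braiding_tensor_right_hom_comp_associator {C : Type u₁} [Category.{v₁} C]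
    [MonoidalCategory C] [BraidedCategory C] (X Y Z : C) :
    (β_ Z (X ⊗ Y)).hom ≫ (α_ X Y Z).hom =
      ((α_ Z X Y).inv ≫ (β_ Z X).hom ▷ Y ≫ (α_ X Z Y).hom) ≫ X ◁ (β_ Z Y).hom := by
  simp

namespace UnitalBFunctorStructure

variable {C : Type u₁} [Category.{v₁} C] [MonoidalCategory C] [BraidedCategory C]
  {D : Type u₂} [Category.{v₂} D] [MonoidalCategory D] [BraidedCategory D] {F : C ⥤ D}
  (t : UnitalBFunctorStructure (unitalBDataOfBraided C) (unitalBDataOfBraided D) F)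

/-- The isomorphisms `F (X ⊗ Y) ≅ F X ⊗ F Y` of a unital b-functor between braided monoidal
categories. -/
def tensorIso (X Y : C) : F.obj (X ⊗ Y) ≅ F.obj X ⊗ F.obj Y := t.iso X Y

/-- The isomorphism `F (𝟙_ C) ≅ 𝟙_ D` of a unital b-functor between braided monoidal
categories. -/
def unitIso : F.obj (𝟙_ C) ≅ 𝟙_ D := t.φ

theorem map_whiskerRight_tensorIso {X X' : C} (f : X ⟶ X') (Y : C) :
    F.map (f ▷ Y) ≫ (t.tensorIso X' Y).hom = (t.tensorIso X Y).hom ≫ F.map f ▷ F.obj Y := by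
  rw [← tensorHom_id, ← tensorHom_id, ← F.map_id]
  exact t.iso_natural f (𝟙 Y)

theorem map_whiskerLeft_tensorIso (X : C) {Y Y' : C} (f : Y ⟶ Y') :
    F.map (X ◁ f) ≫ (t.tensorIso X Y').hom = (t.tensorIso X Y).hom ≫ F.obj X ◁ F.map f := by
  rw [← id_tensorHom, ← id_tensorHom, ← F.map_id]
  exact t.iso_natural (𝟙 X) f

theorem tensorIso_β (X Y Z : C) :
    (t.tensorIso X (Y ⊗ Z)).hom ≫ F.obj X ◁ (t.tensorIso Y Z).hom ≫
        (α_ (F.obj X) (F.obj Y) (F.obj Z)).inv ≫ (β_ (F.obj X) (F.obj Y)).hom ▷ F.obj Z ≫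
          (α_ (F.obj Y) (F.obj X) (F.obj Z)).hom =
      F.map ((α_ X Y Z).inv ≫ (β_ X Y).hom ▷ Z ≫ (α_ Y X Z).hom) ≫
        (t.tensorIso Y (X ⊗ Z)).hom ≫ F.obj Y ◁ (t.tensorIso X Z).hom := by
  rw [← id_tensorHom, ← id_tensorHom]
  exact t.iso_β X Y Z

theorem tensorIso_rightUnitor (X : C) :
    (t.tensorIso X (𝟙_ C)).hom ≫ F.obj X ◁ t.unitIso.hom ≫ (ρ_ (F.obj X)).hom =
      F.map (ρ_ X).hom := by
  rw [← id_tensorHom]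
  exact t.iso_ρ X

theorem tensorIso_braiding (X Y : C) :
    (t.tensorIso X Y).hom ≫ (β_ (F.obj X) (F.obj Y)).hom =
      F.map (β_ X Y).hom ≫ (t.tensorIso Y X).hom := by
  -- Compatibility with β at Z = I; the added factor removes F(I) through φ and ρ, so that β becomes
  -- c.
  have h := congrArg (· ≫ F.obj Y ◁ (F.obj X ◁ t.unitIso.hom ≫ (ρ_ (F.obj X)).hom))
    (t.tensorIso_β X Y (𝟙_ C))
  have hβ : (F.obj X ◁ (t.tensorIso Y (𝟙_ C)).hom) ≫
      ((α_ (F.obj X) (F.obj Y) (F.obj (𝟙_ C))).inv ≫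
        (β_ (F.obj X) (F.obj Y)).hom ▷ F.obj (𝟙_ C) ≫
          (α_ (F.obj Y) (F.obj X) (F.obj (𝟙_ C))).hom) ≫
        F.obj Y ◁ (F.obj X ◁ t.unitIso.hom ≫ (ρ_ (F.obj X)).hom) =
      F.obj X ◁ ((t.tensorIso Y (𝟙_ C)).hom ≫ F.obj Y ◁ t.unitIso.hom ≫ (ρ_ (F.obj Y)).hom) ≫
        (β_ (F.obj X) (F.obj Y)).hom := by
    simp only [Category.assoc, whiskerLeft_comp]
    rw [← associator_naturality_right_assoc, ← whisker_exchange_assoc,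
      ← associator_inv_naturality_right_assoc]
    simp
  simp only [Category.assoc] at h hβ
  rw [hβ, ← whiskerLeft_comp, tensorIso_rightUnitor, tensorIso_rightUnitor,
    ← reassoc_of% (t.map_whiskerLeft_tensorIso X), ← map_whiskerLeft_tensorIso,
    ← F.map_comp_assoc, Category.assoc, Category.assoc, whiskerLeft_rightUnitor,
    whiskerLeft_rightUnitor] at h
  -- The cancelled morphism is F(1_X ⊗ ρ_Y), in the form given by `whiskerLeft_rightUnitor`.
  rw [← cancel_epi (F.map ((α_ X Y (𝟙_ C)).inv ≫ (ρ_ (X ⊗ Y)).hom)), h]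
  simp

/-- After precomposition with F(c_{Z,XY}), the associators on both sides turn into β and c, which F
is already known to respect. -/
theorem tensorIso_associator (X Y Z : C) :
    (t.tensorIso (X ⊗ Y) Z).hom ≫ (t.tensorIso X Y).hom ▷ F.obj Z ≫
        (α_ (F.obj X) (F.obj Y) (F.obj Z)).hom =
      F.map (α_ X Y Z).hom ≫ (t.tensorIso X (Y ⊗ Z)).hom ≫ F.obj X ◁ (t.tensorIso Y Z).hom := by
  rw [← cancel_epi (F.map (β_ Z (X ⊗ Y)).hom), ← F.map_comp_assoc,
    braiding_tensor_right_hom_comp_associator,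
    ← reassoc_of% (t.tensorIso_braiding Z (X ⊗ Y)), ← braiding_naturality_right_assoc,
    braiding_tensor_right_hom_comp_associator,
    F.map_comp_assoc, reassoc_of% (t.map_whiskerLeft_tensorIso X), ← whiskerLeft_comp,
    ← tensorIso_braiding, whiskerLeft_comp, ← reassoc_of% (t.tensorIso_β Z X Y)]
  simp only [Category.assoc]

theorem tensorIso_leftUnitor (X : C) :
    (t.tensorIso (𝟙_ C) X).hom ≫ t.unitIso.hom ▷ F.obj X ≫ (λ_ (F.obj X)).hom =
      F.map (λ_ X).hom := by
  rw [← braiding_rightUnitor, ← braiding_rightUnitor, braiding_naturality_left_assoc,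
    reassoc_of% (t.tensorIso_braiding (𝟙_ C) X), tensorIso_rightUnitor, F.map_comp]

/-- The monoidal functor structure underlying a unital b-functor structure. -/
def toCoreMonoidal : F.CoreMonoidal :=
  .mk' t.unitIso.symm (fun X Y => (t.tensorIso X Y).symm)
    (fun f Y => (t.map_whiskerRight_tensorIso f Y).symm)
    (fun X f => (t.map_whiskerLeft_tensorIso X f).symm)
    t.tensorIso_associator
    (fun X => by
      rw [← cancel_mono (λ_ (F.obj X)).hom]
      simp [t.tensorIso_leftUnitor])
    (fun X => by
      rw [← cancel_mono (ρ_ (F.obj X)).hom]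
      simp [t.tensorIso_rightUnitor])

/-- The braided functor structure of a unital b-functor between braided monoidal categories. -/
abbrev toBraided : F.Braided where
  toMonoidal := t.toCoreMonoidal.toMonoidal
  braided X Y := by
    change (t.tensorIso X Y).inv ≫ _ = _ ≫ (t.tensorIso Y X).inv
    rw [Iso.inv_comp_eq, ← Category.assoc, Iso.eq_comp_inv, tensorIso_braiding]

/-- The unital b-functor structure of a braided functor. -/
def ofBraided (F : C ⥤ D) [F.Braided] :
    UnitalBFunctorStructure (unitalBDataOfBraided C) (unitalBDataOfBraided D) F where
  iso X Y := (Functor.Monoidal.μIso F X Y).symm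
  iso_natural f g := Functor.OplaxMonoidal.δ_natural F f g |>.symm
  iso_β X Y Z := by
    change Functor.OplaxMonoidal.δ F X (Y ⊗ Z) ≫
      (𝟙 (F.obj X) ⊗ₘ Functor.OplaxMonoidal.δ F Y Z) ≫
        (α_ (F.obj X) (F.obj Y) (F.obj Z)).inv ≫ (β_ (F.obj X) (F.obj Y)).hom ▷ F.obj Z ≫
          (α_ (F.obj Y) (F.obj X) (F.obj Z)).hom =
      F.map ((α_ X Y Z).inv ≫ (β_ X Y).hom ▷ Z ≫ (α_ Y X Z).hom) ≫
        Functor.OplaxMonoidal.δ F Y (X ⊗ Z) ≫ (𝟙 (F.obj Y) ⊗ₘ Functor.OplaxMonoidal.δ F X Z)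
    simp only [id_tensorHom, F.map_comp, Category.assoc, ← Functor.OplaxMonoidal.associativity,
      ← Functor.OplaxMonoidal.δ_natural_left_assoc, Functor.OplaxMonoidal.associativity_inv_assoc]
    rw [← comp_whiskerRight_assoc, ← comp_whiskerRight_assoc, Functor.map_braiding,
      Category.assoc, Category.assoc, Functor.Monoidal.μ_δ, Category.comp_id]
  φ := (Functor.Monoidal.εIso F).symm
  iso_ρ X := by
    change Functor.OplaxMonoidal.δ F X (𝟙_ C) ≫
      (𝟙 (F.obj X) ⊗ₘ Functor.OplaxMonoidal.η F) ≫ (ρ_ (F.obj X)).hom = F.map (ρ_ X).hom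
    simp

end UnitalBFunctorStructure

/-- The oplax part determines a strong monoidal structure, and being braided is a property of it. -/
theorem braided_ext {C : Type u₁} [Category.{v₁} C] [MonoidalCategory C] [BraidedCategory C]
    {D : Type u₂} [Category.{v₂} D] [MonoidalCategory D] [BraidedCategory D] {F : C ⥤ D}
    (h h' : F.Braided) (hδ : ∀ X Y, h.δ X Y = h'.δ X Y) (hη : h.η = h'.η) : h = h' := by
  have key : h.toMonoidal = h'.toMonoidal := by
    apply Functor.Monoidal.toOplaxMonoidal_injective
    ext
    · exact hη
    · exact hδ _ _
  cases h
  cases h'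
  cases key
  rfl

/-- Unital b-functor structures are equivalent to braided functor structures. -/
def unitalBFunctorStructureEquiv {C : Type u₁} [Category.{v₁} C] [MonoidalCategory C]
    [BraidedCategory C] {D : Type u₂} [Category.{v₂} D] [MonoidalCategory D] [BraidedCategory D]
    (F : C ⥤ D) :
    UnitalBFunctorStructure (unitalBDataOfBraided C) (unitalBDataOfBraided D) F ≃ F.Braided where
  toFun t := t.toBraided
  invFun _ := .ofBraided F
  left_inv _ := rfl
  right_inv _ := braided_ext _ _ (fun _ _ => rfl) rfl

end BCat

theorem theorem2p3 :
    (∀ (C : Type u₁) [Category.{v₁} C],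
      ∃ e : BCat.UnitalBStructure C ≃ BCat.BraidedMonoidalStructure C,
        (∀ U, (e U).toData = U.toUnitalBData.toBraidedMonoidalData) ∧
        (∀ B, (e.symm B).toUnitalBData = B.toUnitalBData) ∧
        ∃ s : {U : BCat.UnitalBStructure C // U.toBData.IsSymmetric} ≃
            BCat.SymmetricMonoidalStructure C,
          ∀ U, (s U).toBraided = e U.1) ∧
    (∀ (C : Type u₁) [Category.{v₁} C] [MonoidalCategory C] [BraidedCategory C]
      (D : Type u₂) [Category.{v₂} D] [MonoidalCategory D] [BraidedCategory D] (F : C ⥤ D),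
      ∃ f : BCat.UnitalBFunctorStructure
          (BCat.unitalBDataOfBraided C) (BCat.unitalBDataOfBraided D) F ≃ F.Braided,
        ∀ t : BCat.UnitalBFunctorStructure
            (BCat.unitalBDataOfBraided C) (BCat.unitalBDataOfBraided D) F,
          (∀ X Y : C, (f t).δ X Y = (t.iso X Y).hom) ∧ (f t).η = t.φ.hom) :=
  ⟨fun C _ => ⟨BCat.unitalBStructureEquiv C, fun U => U.toBraidedMonoidalStructure_toData,
    fun _ => rfl, BCat.symmetricUnitalBStructureEquiv C,
    BCat.symmetricUnitalBStructureEquiv_toBraided⟩,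
  fun _ _ _ _ _ _ _ _ F => ⟨BCat.unitalBFunctorStructureEquiv F,
    fun _ => ⟨fun _ _ => rfl, rfl⟩⟩⟩
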